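/- Let $0<p<1$ be fixed and let $G(n,p)$ be the Erd\H{o}s--R\'enyi random graph on $n$ labelled vertices, in which each pair of distinct vertices is joined by an edge independently with probability $p$. For vertices $w,v$ of a graph, let $H_{wv}\in[0,\infty]$ be the hitting time, i.e. the expected number of steps that a simple random walk started at $w$ needs to reach $v$ for the first time. Then there is a constant $C=C(p)>0$, depending only on $p$, such that the following event has probability tending to $1$ as $n\to\infty$: simultaneously for all vertices $v$ and all vertices $w\neq v$ of $G(n,p)$, the hitting time $H_{wv}$ is finite and $$\left| H_{wv} - \left(\frac{2|E|}{\deg(v)} + \begin{cases} -1 & \text{if } \{w,v\}\in E,\\ -1+\frac1p & \text{if } \{w,v\}\notin E\end{cases}\right)\right| \le C\,\frac{(\log n)^{3/2}}{\sqrt n},$$ where $|E|$ is the number of edges of the graph and $\deg(v)$ is the degree of $v$. -/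

import Mathlib

open MeasureTheory ProbabilityTheory Filter
open scoped Topology ENNReal unitInterval

namespace RandomWalk

variable {V : Type*} [Finite V] [MeasurableSpace V] [MeasurableSingletonClass V]

open scoped Classical in
/-- The law of one step of simple random walk on `G` from the vertex `x`: uniform on the neighbours
of `x`. A walk at an isolated vertex, which has nowhere to go, stays there. -/
noncomputable def stepLaw (G : SimpleGraph V) (x : V) : Measure V :=
  if (G.neighborSet x).Nonempty then uniformOn (G.neighborSet x) else Measure.dirac x

/-- The transition kernel of simple random walk on `G`. -/
noncomputable def stepKernel (G : SimpleGraph V) : Kernel V V :=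
  Kernel.ofFunOfCountable (stepLaw G)

instance (G : SimpleGraph V) : IsMarkovKernel (stepKernel G) where
  isProbabilityMeasure x := by
    change IsProbabilityMeasure (stepLaw G x)
    unfold stepLaw
    split_ifs with h
    · exact isProbabilityMeasure_uniformOn (Set.toFinite _) h
    · infer_instance

/-- The same transition, as a kernel from the history `X 0, …, X k` of the walk to `X (k + 1)`;
it depends on the history only through `X k`. -/
noncomputable def historyKernel (G : SimpleGraph V) (k : ℕ) :
    Kernel ((i : Finset.Iic k) → (fun _ : ℕ => V) i) V :=
  (stepKernel G).comap (fun x => x ⟨k, Finset.mem_Iic.2 le_rfl⟩) (measurable_pi_apply _)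

instance (G : SimpleGraph V) (k : ℕ) : IsMarkovKernel (historyKernel G k) := by
  unfold historyKernel
  infer_instance

/-- The law, on the space of trajectories `ℕ → V`, of simple random walk on `G` started at `w`. -/
noncomputable def walkLaw (G : SimpleGraph V) (w : V) : Measure (ℕ → V) :=
  Kernel.trajMeasure (X := fun _ : ℕ => V) (Measure.dirac w) (historyKernel G)

/-- The first time at which the trajectory `ω` is at `v` (it is `⊤` if `ω` never visits `v`). -/
noncomputable def firstVisit (v : V) (ω : ℕ → V) : ℕ∞ :=
  hittingAfter (fun (k : ℕ) (ω : ℕ → V) => ω k) {v} 0 ω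

/-- The hitting time `H_{wv}`: the expected number of steps that simple random walk on `G` started
at `w` needs to reach `v` for the first time, a value in `[0, ∞]`. -/
noncomputable def hittingTime (G : SimpleGraph V) (w v : V) : ℝ≥0∞ :=
  ∫⁻ ω, (firstVisit v ω : ℝ≥0∞) ∂(walkLaw G w)

end RandomWalk

/-!
Fix the target `v`. The function `H w = H_{wv}` solves `deg w * H w - ∑_{x ~ w} H x = deg w` for
`w ≠ v`, with `H v = 0`. The explicit function `f` of the statement (`profile`), extended by
`f v = 0`, solves the same equation up to a small relative error: this is a computation which only
uses that all degrees are about `p n` and all numbers of common neighbours about `p ^ 2 n`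
(`IsQuasirandom`). Two consequences follow.

* As the relative error is at most `1 / 2`, the function `2 f` is a supersolution, so it bounds the
  partial sums of `∑ k, P_w (v not visited up to time k)`, and `H` is finite
  (`hittingTime_ne_top_of_supersolution`).
* The constant in `f` is chosen so that `f` and `H` have the same sum over the neighbours of `v`,
  by Kac's formula (`IsQuasirandom.sum_mul_eq_of_hitting_equation`). Hence `e = H - f` satisfies
  `deg x * e x - ∑_{y ~ x} e y = deg x * r x` at *every* vertex, `v` included, with a small `r`.

Such an equation can be inverted with a loss which is a constant. After subtracting a constant from
`e`, its degree-weighted sum vanishes. Applying the adjacency operator twice turns `e` into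
`∑ x, codeg (w, x) * e x`; since `codeg (w, x) - p * deg x` is small off the diagonal, this
expression is a small multiple of `n ^ 2 * max |e|`, and `e` is controlled by `r`
(`IsQuasirandom.abs_le_of_sum_eq_zero`). This replaces a spectral gap estimate. The result is
`|H w - f w| = O(η)`, where `η n` bounds the deviations of degrees and codegrees.

For `G(n, p)`, each degree and codegree is a sum of independent indicators, and Hoeffding's
inequality with a union bound over pairs of vertices gives quasirandomness with
`η = 4 √(log n / n)` outside an event of probability at most `2 / n`. In particular the deviation
of the hitting times is even `O(√(log n / n))`.
-/

namespace RandomWalk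

/-! ### First-step analysis of the hitting time -/

section Walk

open scoped Classical in
/-- The tail sum for the first visit time, also when it is infinite. -/
theorem firstVisit_eq_tsum {V : Type*} (v : V) (ω : ℕ → V) :
    (firstVisit v ω : ℝ≥0∞) = ∑' k : ℕ, if ∀ j ≤ k, ω j ≠ v then 1 else 0 := by
  have key : ∀ k : ℕ, (∀ j ≤ k, ω j ≠ v) ↔ (k : ℕ∞) < firstVisit v ω := by
    intro k
    have := hittingAfter_le_iff (u := fun (k : ℕ) (ω : ℕ → V) => ω k) (s := {v}) (n := 0)
      (ω := ω) (i := k)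
    rw [← not_le]
    refine Iff.trans ?_ (not_congr this.symm)
    simp
  simp only [key]
  generalize firstVisit v ω = T
  induction T using ENat.recTopCoe with
  | top => simp
  | coe m =>
    rw [tsum_eq_sum (s := Finset.range m) (by intro k hk; simpa using hk)]
    rw [Finset.sum_congr rfl (g := fun _ => (1 : ℝ≥0∞)) (by intro k hk; simpa using hk)]
    simp

variable {V : Type*} [Finite V] [MeasurableSpace V] [MeasurableSingletonClass V]

/-- The Markov property for the last step of a finite piece of trajectory. -/
theorem lintegral_walkLaw_succ (G : SimpleGraph V) (w : V) (k : ℕ)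
    (F : ((i : Finset.Iic k) → (fun _ : ℕ => V) i) → V → ℝ≥0∞) :
    ∫⁻ ω, F (Preorder.frestrictLe k ω) (ω (k + 1)) ∂(walkLaw G w) =
      ∫⁻ ω, ∫⁻ y, F (Preorder.frestrictLe k ω) y ∂(stepLaw G (ω k)) ∂(walkLaw G w) := by
  have h := Kernel.map_frestrictLe_trajMeasure_compProd_eq_map_trajMeasure
    (X := fun _ : ℕ => V) (μ₀ := Measure.dirac w) (κ := historyKernel G) (a := k)
  have hF : Measurable (Function.uncurry F) := measurable_of_finite _
  have h1 := congrArg (fun μ => ∫⁻ z, Function.uncurry F z ∂μ) h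
  simp only at h1
  rw [lintegral_map hF (by fun_prop), Measure.lintegral_compProd hF,
    lintegral_map (measurable_of_finite _) (by fun_prop)] at h1
  exact h1.symm

theorem lintegral_walkLaw_zero (G : SimpleGraph V) (w : V) (φ : V → ℝ≥0∞) :
    ∫⁻ ω, φ (ω 0) ∂(walkLaw G w) = φ w := by
  have : (walkLaw G w).map (Preorder.frestrictLe 0) =
      (Measure.dirac w).map (MeasurableEquiv.piUnique (fun _ : Finset.Iic 0 => V)).symm := by
    unfold walkLaw Kernel.trajMeasure
    rw [Measure.map_comp _ _ (by fun_prop), Kernel.traj_map_frestrictLe,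
      Kernel.partialTraj_self, Measure.id_comp]
  have h1 := congrArg (fun μ => ∫⁻ z, φ (z ⟨0, Finset.mem_Iic.2 le_rfl⟩) ∂μ) this
  rw [lintegral_map (measurable_of_finite _) (by fun_prop),
    lintegral_map (measurable_of_finite _) (by fun_prop),
    lintegral_dirac] at h1
  exact h1

open scoped Classical in
/-- One step of the walk killed on entering `v`, as an operator on functions. -/
noncomputable def killedStep (G : SimpleGraph V) (v : V) (φ : V → ℝ≥0∞) (x : V) : ℝ≥0∞ :=
  ∫⁻ y, (if y = v then 0 else φ y) ∂(stepLaw G x)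

open scoped Classical in
/-- The trajectory law decomposes at the last step, which makes the iterates of the killed operator
act on `φ` from the inside; since they commute, this is also a decomposition at the first step. -/
theorem lintegral_walkLaw_avoiding (G : SimpleGraph V) (v w : V) (k : ℕ) (φ : V → ℝ≥0∞) :
    ∫⁻ ω, (if ∀ j ≤ k, ω j ≠ v then φ (ω k) else 0) ∂(walkLaw G w) =
      if w = v then 0 else (killedStep G v)^[k] φ w := by
  induction k generalizing φ with
  | zero =>
    simpa using lintegral_walkLaw_zero G w (fun x => if x = v then 0 else φ x)
  | succ k ih =>
    rw [Function.iterate_succ_apply, ← ih]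
    have := lintegral_walkLaw_succ G w k
      (fun x y => if ∀ j : Finset.Iic k, x j ≠ v then (if y = v then 0 else φ y) else 0)
    refine Eq.trans ?_ (this.trans ?_)
    · refine lintegral_congr fun ω => ?_
      simp only [Preorder.frestrictLe_apply, Subtype.forall, Finset.mem_Iic,
        Nat.le_succ_iff_eq_or_le, forall_eq_or_imp]
      split_ifs <;> simp_all
    · refine lintegral_congr fun ω => ?_
      simp only [Preorder.frestrictLe_apply, Subtype.forall, Finset.mem_Iic]
      split_ifs <;> simp [killedStep]

open scoped Classical in
theorem hittingTime_eq_tsum (G : SimpleGraph V) (w v : V) :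
    hittingTime G w v = if w = v then 0 else ∑' k : ℕ, (killedStep G v)^[k] 1 w := by
  unfold hittingTime
  simp only [firstVisit_eq_tsum]
  rw [lintegral_tsum]
  · have h := fun k => lintegral_walkLaw_avoiding G v w k 1
    simp only [Pi.one_apply] at h
    simp only [h]
    split_ifs <;> simp
  · intro k
    refine (Measurable.ite ?_ measurable_const measurable_const).aemeasurable
    exact measurableSet_setOfPred.2 (by fun_prop)

theorem hittingTime_self (G : SimpleGraph V) (v : V) : hittingTime G v v = 0 := by
  simp [hittingTime_eq_tsum]

theorem killedStep_tsum (G : SimpleGraph V) (v x : V) :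
    killedStep G v (fun y => ∑' k : ℕ, (killedStep G v)^[k] 1 y) x =
      ∑' k : ℕ, (killedStep G v)^[k + 1] 1 x := by
  classical
  simp only [Function.iterate_succ_apply']
  unfold killedStep
  rw [← lintegral_tsum fun k => (measurable_of_finite _).aemeasurable]
  refine lintegral_congr fun y => ?_
  split_ifs <;> simp

theorem hittingTime_eq_one_add (G : SimpleGraph V) {w v : V} (h : w ≠ v) :
    hittingTime G w v = 1 + ∫⁻ y, hittingTime G y v ∂(stepLaw G w) := by
  classical
  have h1 := killedStep_tsum G v w
  have h2 : ∫⁻ y, hittingTime G y v ∂(stepLaw G w) =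
      ∑' k : ℕ, (killedStep G v)^[k + 1] 1 w := by
    rw [← h1]
    simp only [hittingTime_eq_tsum]
    rfl
  rw [h2, hittingTime_eq_tsum, if_neg h, tsum_eq_zero_add' ENNReal.summable]
  simp

/-- The hitting time is the least nonnegative solution of its first-step equation. -/
theorem hittingTime_le_of_supersolution (G : SimpleGraph V) (v : V) (g : V → ℝ≥0∞)
    (hg : ∀ x, x ≠ v → 1 + ∫⁻ y, g y ∂(stepLaw G x) ≤ g x) (w : V) :
    hittingTime G w v ≤ g w := by
  classical
  have key : ∀ N x, x ≠ v → ∑ k ∈ Finset.range N, (killedStep G v)^[k] 1 x ≤ g x := by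
    intro N
    induction N with
    | zero => simp
    | succ N ih =>
      intro x hx
      refine le_trans ?_ (hg x hx)
      rw [Finset.sum_range_succ']
      simp only [Function.iterate_succ_apply', Function.iterate_zero, id, Pi.one_apply]
      rw [add_comm]
      gcongr
      have hsum : ∑ k ∈ Finset.range N, killedStep G v ((killedStep G v)^[k] 1) x =
          ∫⁻ y, ∑ k ∈ Finset.range N, (if y = v then 0 else (killedStep G v)^[k] 1 y)
            ∂(stepLaw G x) :=
        (lintegral_finsetSum _ fun k _ => measurable_of_finite _).symm
      rw [hsum]
      refine lintegral_mono fun y => ?_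
      by_cases hy : y = v
      · simp [hy]
      · simpa only [hy, if_false] using ih y hy
  rw [hittingTime_eq_tsum]
  split_ifs with h
  · exact zero_le
  · exact ENNReal.tsum_le_of_sum_range_le fun N => key N w h

end Walk

section Fintype

variable {V : Type*} [Fintype V] [MeasurableSpace V] [MeasurableSingletonClass V]

open scoped Classical in
theorem lintegral_stepLaw (G : SimpleGraph V) {x : V} (hx : 0 < G.degree x)
    (φ : V → ℝ≥0∞) :
    ∫⁻ y, φ y ∂(stepLaw G x) = (∑ y ∈ G.neighborFinset x, φ y) / G.degree x := by
  have hne : (G.neighborSet x).Nonempty := by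
    rw [← G.coe_neighborFinset x, Finset.coe_nonempty, ← Finset.card_pos]
    simpa using hx
  rw [stepLaw, if_pos hne, congrArg uniformOn (G.coe_neighborFinset x).symm, uniformOn,
    ProbabilityTheory.cond, lintegral_smul_measure, Measure.count_apply_finset, lintegral_finset]
  simp [ENNReal.div_eq_inv_mul]

open scoped Classical in
theorem hittingTime_mul_degree (G : SimpleGraph V) {w v : V} (h : w ≠ v)
    (hw : 0 < G.degree w) (hfin : ∀ x, hittingTime G x v ≠ ∞) :
    (G.degree w : ℝ) * (hittingTime G w v).toReal =
      G.degree w + ∑ x ∈ G.neighborFinset w, (hittingTime G x v).toReal := by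
  have h1 := hittingTime_eq_one_add G h
  rw [lintegral_stepLaw G hw] at h1
  have h2 := congrArg ENNReal.toReal h1
  rw [ENNReal.toReal_add (by simp) (ENNReal.div_ne_top (ENNReal.sum_ne_top.2 fun x _ => hfin x)
    (by simpa using hw.ne')), ENNReal.toReal_div, ENNReal.toReal_sum fun x _ => hfin x] at h2
  rw [h2]
  have : (G.degree w : ℝ) ≠ 0 := by exact_mod_cast hw.ne'
  simp
  field_simp

open scoped Classical in
theorem hittingTime_ne_top_of_supersolution (G : SimpleGraph V) (v : V)
    (hd : ∀ x, 0 < G.degree x) (g : V → ℝ) (hg0 : ∀ x, 0 ≤ g x)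
    (hg : ∀ x, x ≠ v →
      (G.degree x : ℝ) + ∑ y ∈ G.neighborFinset x, g y ≤ G.degree x * g x) (w : V) :
    hittingTime G w v ≠ ∞ := by
  refine ne_top_of_le_ne_top (ENNReal.ofReal_ne_top (r := g w))
    (hittingTime_le_of_supersolution G v (fun x => ENNReal.ofReal (g x)) (fun x hx => ?_) w)
  have hdx : (0 : ℝ) < G.degree x := by exact_mod_cast hd x
  rw [lintegral_stepLaw G (hd x), ← ENNReal.ofReal_sum_of_nonneg fun y _ => hg0 y,
    ← ENNReal.ofReal_natCast, ← ENNReal.ofReal_div_of_pos hdx, ← ENNReal.ofReal_one,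
    ← ENNReal.ofReal_add zero_le_one (div_nonneg (Finset.sum_nonneg fun y _ => hg0 y) hdx.le)]
  refine ENNReal.ofReal_le_ofReal ?_
  have := hg x hx
  rw [← mul_le_mul_iff_right₀ hdx]
  field_simp
  linarith

end Fintype

/-! ### Inverting the equation on a quasirandom graph -/

/-- `a` is the adjacency matrix of a graph in which every degree and every number of common
neighbours agrees, up to an error `η * |V|`, with its expectation under edge density `p`. The bounds
on `η` say that the error is small compared with `p ^ 2` and that it is at least one vertex. -/
structure IsQuasirandom {V : Type*} [Fintype V] (a : Matrix V V ℝ) (p η : ℝ) : Prop where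
  isAdjMatrix : a.IsAdjMatrix
  pos : 0 < p
  lt_one : p < 1
  error_le : η ≤ p ^ 2 / 32
  one_le : 1 ≤ η * Fintype.card V
  degree : ∀ x, |∑ y, a x y - p * Fintype.card V| ≤ η * Fintype.card V
  codegree : ∀ x y, x ≠ y → |∑ z, a x z * a z y - p ^ 2 * Fintype.card V| ≤ η * Fintype.card V

namespace IsQuasirandom

variable {V : Type*} [Fintype V] {a : Matrix V V ℝ} {p η : ℝ}

theorem symm (h : IsQuasirandom a p η) (x y : V) : a x y = a y x :=
  h.isAdjMatrix.symm.apply y x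

theorem nonneg (h : IsQuasirandom a p η) (x y : V) : 0 ≤ a x y := by
  rcases h.isAdjMatrix.zero_or_one x y with h | h <;> simp [h]

theorem le_one (h : IsQuasirandom a p η) (x y : V) : a x y ≤ 1 := by
  rcases h.isAdjMatrix.zero_or_one x y with h | h <;> simp [h]

theorem card_pos (h : IsQuasirandom a p η) : (0 : ℝ) < Fintype.card V := by
  rcases (Nat.cast_nonneg (α := ℝ) (Fintype.card V)).eq_or_lt with h0 | h0
  · have := h.one_le
    rw [← h0] at this
    linarith
  · exact h0

theorem error_pos (h : IsQuasirandom a p η) : 0 < η :=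
  pos_of_mul_pos_left (zero_lt_one.trans_le h.one_le) h.card_pos.le

theorem degree_le (h : IsQuasirandom a p η) (x : V) : ∑ y, a x y ≤ Fintype.card V := by
  calc ∑ y, a x y ≤ ∑ _y : V, (1 : ℝ) := Finset.sum_le_sum fun y _ => h.le_one x y
    _ = Fintype.card V := by simp

theorem le_degree (h : IsQuasirandom a p η) (x : V) :
    p / 2 * Fintype.card V ≤ ∑ y, a x y := by
  have h1 := (abs_le.1 (h.degree x)).1
  have hn := h.card_pos
  have : η ≤ p / 2 := by nlinarith [h.error_le, h.pos, h.lt_one]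
  nlinarith

theorem degree_pos (h : IsQuasirandom a p η) (x : V) : 0 < ∑ y, a x y :=
  lt_of_lt_of_le (mul_pos (half_pos h.pos) h.card_pos) (h.le_degree x)

/-- The left side is what remains of the codegree when it is tested against a function of vanishing
degree-weighted sum. On the diagonal the codegree is the degree, and only the trivial bound holds. -/
theorem abs_codegree_sub_le [DecidableEq V] (h : IsQuasirandom a p η) (w x : V) :
    |∑ z, a w z * a z x - p * ∑ y, a x y| ≤
      2 * η * Fintype.card V + if x = w then (Fintype.card V : ℝ) else 0 := by
  have hn := h.card_pos
  have hη := h.error_pos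
  have hp := h.pos
  have hp1 := h.lt_one
  split_ifs with hx
  · have h1 : ∑ z, a w z * a z x ≤ ∑ z, a w z :=
      Finset.sum_le_sum fun z _ => mul_le_of_le_one_right (h.nonneg _ _) (h.le_one _ _)
    have h2 : 0 ≤ ∑ z, a w z * a z x :=
      Finset.sum_nonneg fun z _ => mul_nonneg (h.nonneg _ _) (h.nonneg _ _)
    have h3 := h.degree_le w
    have h4 := h.degree_le x
    have h5 := h.degree_pos x
    have : 0 ≤ 2 * η * Fintype.card V := by positivity
    rw [abs_le]
    constructor <;> nlinarith
  · have h1 := abs_le.1 (h.codegree w x (Ne.symm hx))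
    have h2 := abs_le.1 (h.degree x)
    have : 0 < η * Fintype.card V := by positivity
    rw [abs_le]
    constructor <;> nlinarith

/-- On functions of vanishing degree-weighted sum, the operator `e ↦ e - P e` (with `P` the averaging
over neighbours) has an inverse which is bounded in the sup norm, uniformly in the graph. -/
theorem abs_le_of_sum_eq_zero (h : IsQuasirandom a p η) {e r : V → ℝ} {ρ : ℝ}
    (he : ∀ x, (∑ y, a x y) * e x - ∑ y, a x y * e y = (∑ y, a x y) * r x)
    (hr : ∀ x, |r x| ≤ ρ) (hsum : ∑ x, (∑ y, a x y) * e x = 0) (x : V) :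
    |e x| ≤ 8 * ρ / p ^ 2 := by
  classical
  have : Nonempty V := ⟨x⟩
  obtain ⟨w, hw⟩ := Finite.exists_max fun x => |e x|
  refine (hw x).trans ?_
  set R := |e w| with hR
  set n : ℝ := (Fintype.card V : ℝ) with hn_def
  have hn : 0 < n := h.card_pos
  have hη := h.error_pos
  have hp := h.pos
  have hp1 := h.lt_one
  have hR0 : 0 ≤ R := abs_nonneg _
  have hρ : 0 ≤ ρ := (abs_nonneg _).trans (hr w)
  set d : V → ℝ := fun x => ∑ y, a x y with hd_def
  have hd0 : ∀ x, 0 < d x := h.degree_pos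
  have hdn : ∀ x, d x ≤ n := h.degree_le
  have hdl : ∀ x, p / 2 * n ≤ d x := h.le_degree
  -- Substituting the equation into itself brings in the codegrees, whose leading part `p * d x`
  -- does not see `e`.
  have hcod : ∑ x, (∑ z, a w z * a z x) * e x = ∑ y, a w y * (d y * e y - d y * r y) := by
    calc ∑ x, (∑ z, a w z * a z x) * e x = ∑ y, a w y * ∑ x, a y x * e x := by
          simp only [Finset.sum_mul, Finset.mul_sum]
          rw [Finset.sum_comm]
          exact Finset.sum_congr rfl fun _ _ => Finset.sum_congr rfl fun _ _ => by ring
      _ = _ := Finset.sum_congr rfl fun y _ => by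
          have := he y
          simp only [hd_def]
          rw [← this]; ring
  have hmain : p * n * d w * e w = p * n * d w * r w +
      ∑ x, (∑ z, a w z * a z x - p * d x) * e x -
      ∑ y, a w y * ((d y - p * n) * e y - d y * r y) := by
    have h1 : ∑ x, (∑ z, a w z * a z x - p * d x) * e x =
        ∑ x, (∑ z, a w z * a z x) * e x - p * ∑ x, d x * e x := by
      rw [Finset.mul_sum, ← Finset.sum_sub_distrib]
      exact Finset.sum_congr rfl fun _ _ => by ring
    have h2 : ∑ y, a w y * ((d y - p * n) * e y - d y * r y) =
        ∑ y, a w y * (d y * e y - d y * r y) - p * n * ∑ y, a w y * e y := by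
      rw [Finset.mul_sum, ← Finset.sum_sub_distrib]
      exact Finset.sum_congr rfl fun _ _ => by ring
    have h3 : ∑ y, a w y * e y = d w * e w - d w * r w := by
      have := he w
      simp only [hd_def]; linarith
    rw [h1, h2, hcod, h3, hsum]; ring
  -- The diagonal term contributes `n * R`, which is at most `η * n ^ 2 * R` as `1 ≤ η * n`.
  have hb1 : |∑ x, (∑ z, a w z * a z x - p * d x) * e x| ≤ 3 * η * n ^ 2 * R := by
    calc |∑ x, (∑ z, a w z * a z x - p * d x) * e x|
        ≤ ∑ x, |(∑ z, a w z * a z x - p * d x) * e x| := Finset.abs_sum_le_sum_abs _ _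
      _ ≤ ∑ x, (2 * η * n + if x = w then n else 0) * R := by
          refine Finset.sum_le_sum fun x _ => ?_
          rw [abs_mul]
          refine mul_le_mul (h.abs_codegree_sub_le w x) (hw x) (abs_nonneg _) ?_
          exact (abs_nonneg _).trans (h.abs_codegree_sub_le w x)
      _ = (2 * η * n ^ 2 + n) * R := by
          rw [← Finset.sum_mul, Finset.sum_add_distrib]
          simp [← hn_def]; left; ring
      _ ≤ 3 * η * n ^ 2 * R := by
          refine mul_le_mul_of_nonneg_right ?_ hR0
          have : 1 ≤ η * n := h.one_le
          nlinarith
  have hb2 : |∑ y, a w y * ((d y - p * n) * e y - d y * r y)| ≤ d w * (η * n * R + n * ρ) := by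
    calc |∑ y, a w y * ((d y - p * n) * e y - d y * r y)|
        ≤ ∑ y, |a w y * ((d y - p * n) * e y - d y * r y)| := Finset.abs_sum_le_sum_abs _ _
      _ ≤ ∑ y, a w y * (η * n * R + n * ρ) := by
          refine Finset.sum_le_sum fun y _ => ?_
          rw [abs_mul, abs_of_nonneg (h.nonneg w y)]
          refine mul_le_mul_of_nonneg_left ((abs_sub _ _).trans ?_) (h.nonneg w y)
          rw [abs_mul, abs_mul, abs_of_pos (hd0 y)]
          exact add_le_add (mul_le_mul (h.degree y) (hw y) (abs_nonneg _) (by positivity))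
            (mul_le_mul (hdn y) (hr y) (abs_nonneg _) hn.le)
      _ = d w * (η * n * R + n * ρ) := by rw [← Finset.sum_mul]
  have hb3 : |p * n * d w * r w| ≤ p * n * d w * ρ := by
    have : 0 < p * n * d w := mul_pos (mul_pos hp hn) (hd0 w)
    rw [abs_mul, abs_of_pos this]
    exact mul_le_mul_of_nonneg_left (hr w) this.le
  have hfin : p * n * d w * R ≤
      p * n * d w * ρ + 3 * η * n ^ 2 * R + d w * (η * n * R + n * ρ) := by
    have : 0 < p * n * d w := mul_pos (mul_pos hp hn) (hd0 w)
    rw [hR, ← abs_of_pos this, ← abs_mul, abs_of_pos this, hmain]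
    refine (abs_sub _ _).trans (add_le_add ((abs_add_le _ _).trans (add_le_add hb3 hb1)) hb2)
  have hdw := hdl w
  have hkey : p * R ≤ p * ρ + 6 * η * R / p + (η * R + ρ) := by
    have h1 : 3 * η * n ^ 2 * R ≤ (n * d w) * (6 * η * R / p) := by
      have h2 : n ≤ 2 * d w / p := by rw [le_div_iff₀ hp]; linarith
      calc 3 * η * n ^ 2 * R = (3 * η * n * R) * n := by ring
        _ ≤ (3 * η * n * R) * (2 * d w / p) := mul_le_mul_of_nonneg_left h2 (by positivity)
        _ = _ := by ring
    have hpos : 0 < n * d w := mul_pos hn (hd0 w)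
    refine le_of_mul_le_mul_left ?_ hpos
    linarith
  have hkey2 : p ^ 2 * R ≤ p ^ 2 * ρ + 6 * η * R + p * (η * R + ρ) := by
    have := mul_le_mul_of_nonneg_left hkey hp.le
    have h2 : p * (6 * η * R / p) = 6 * η * R := by field_simp
    linarith
  rw [le_div_iff₀ (by positivity)]
  have h1 : η * R ≤ p ^ 2 / 32 * R := mul_le_mul_of_nonneg_right h.error_le hR0
  have h2 : p * (η * R + ρ) ≤ η * R + ρ :=
    mul_le_of_le_one_left (by positivity) hp1.le
  have h3 : p ^ 2 * ρ ≤ ρ := mul_le_of_le_one_left hρ (by nlinarith)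
  have h4 : 0 ≤ p ^ 2 * R := by positivity
  linarith

/-- A zero of `e` serves as well as the normalisation of its sum: it bounds the constant that has to
be subtracted, at the cost of a factor two. -/
theorem abs_le_of_apply_eq_zero (h : IsQuasirandom a p η) {e r : V → ℝ} {ρ : ℝ}
    (he : ∀ x, (∑ y, a x y) * e x - ∑ y, a x y * e y = (∑ y, a x y) * r x)
    (hr : ∀ x, |r x| ≤ ρ) {v : V} (hv : e v = 0) (x : V) :
    |e x| ≤ 16 * ρ / p ^ 2 := by
  set D := ∑ x, ∑ y, a x y with hD
  have hD0 : 0 < D := Finset.sum_pos (fun x _ => h.degree_pos x) ⟨v, Finset.mem_univ v⟩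
  set m := (∑ x, (∑ y, a x y) * e x) / D with hm
  have key := h.abs_le_of_sum_eq_zero (e := fun x => e x - m) (r := r) (ρ := ρ) (fun x => by
    rw [← he x]
    simp only [mul_sub, Finset.sum_sub_distrib, ← Finset.sum_mul]
    ring) hr (by
    simp only [mul_sub, Finset.sum_sub_distrib, ← Finset.sum_mul]
    rw [← hD, hm]; field_simp; ring)
  have h1 := key v
  have h2 := key x
  rw [hv, zero_sub, abs_neg] at h1
  calc |e x| = |(e x - m) + m| := by ring_nf
    _ ≤ |e x - m| + |m| := abs_add_le _ _
    _ ≤ 8 * ρ / p ^ 2 + 8 * ρ / p ^ 2 := add_le_add h2 h1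
    _ = _ := by ring



theorem abs_total_div_degree_sub_card_le (h : IsQuasirandom a p η) (v : V) :
    |(∑ x, ∑ y, a x y) / (∑ y, a v y) - Fintype.card V| ≤ 4 * η * Fintype.card V / p := by
  have hd := h.degree_pos v
  have hp := h.pos
  have hη := h.error_pos
  have hn := h.card_pos
  set n : ℝ := (Fintype.card V : ℝ) with hn_def
  have h1 : |∑ x, ∑ y, a x y - p * n * n| ≤ η * n * n := by
    calc |∑ x, ∑ y, a x y - p * n * n| = |∑ x, (∑ y, a x y - p * n)| := by
          rw [Finset.sum_sub_distrib]; simp [← hn_def]; ring_nf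
      _ ≤ ∑ x, |∑ y, a x y - p * n| := Finset.abs_sum_le_sum_abs _ _
      _ ≤ ∑ _x : V, η * n := Finset.sum_le_sum fun x _ => h.degree x
      _ = η * n * n := by simp [← hn_def]; ring
  have h2 := abs_le.1 h1
  have h3 := abs_le.1 (h.degree v)
  have h4 := h.le_degree v
  rw [show (∑ x, ∑ y, a x y) / (∑ y, a v y) - n =
    (∑ x, ∑ y, a x y - n * ∑ y, a v y) / (∑ y, a v y) by field_simp, abs_div, abs_of_pos hd,
    div_le_div_iff₀ hd hp]
  have h5 : |∑ x, ∑ y, a x y - n * ∑ y, a v y| ≤ 2 * η * n * n := by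
    rw [abs_le]; constructor <;> nlinarith
  have h6 : (2 * η * n * n) * p ≤ 4 * η * n * ∑ y, a v y := by
    have : (4 * η * n) * (p / 2 * n) ≤ (4 * η * n) * ∑ y, a v y :=
      mul_le_mul_of_nonneg_left h4 (by positivity)
    linarith
  exact (mul_le_mul_of_nonneg_right h5 hp.le).trans h6

end IsQuasirandom

/-! ### The approximate hitting times -/

section Profile

variable {V : Type*} [Fintype V] {a : Matrix V V ℝ} {p η : ℝ}

open scoped Classical in
/-- The approximate hitting times of `v` on the graph with adjacency matrix `a`:
`2|E| / deg v - 1 + 1 / p`, less `1 / p` at neighbours of `v`, and `0` at `v`. Here `2|E|` is the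
sum of the degrees. -/
noncomputable def profile (a : Matrix V V ℝ) (p : ℝ) (v x : V) : ℝ :=
  if x = v then 0 else (∑ x, ∑ y, a x y) / (∑ y, a v y) - 1 + 1 / p - a x v / p

/-- The error, relative to the degree, with which `profile` solves the hitting time equation away
from `v`. -/
noncomputable def residual (a : Matrix V V ℝ) (p : ℝ) (v x : V) : ℝ :=
  (∑ z, a x z * a z v / p - ∑ y, a x y +
    a x v * ((∑ x, ∑ y, a x y) / (∑ y, a v y) - 1 + 1 / p - (∑ y, a x y) / p)) / ∑ y, a x y

theorem sum_mul_profile (ha : a.IsAdjMatrix) (x v : V) :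
    ∑ y, a x y * profile a p v y =
      (∑ y, a x y - a x v) * ((∑ x, ∑ y, a x y) / (∑ y, a v y) - 1 + 1 / p) -
        ∑ z, a x z * a z v / p := by
  classical
  set B := (∑ x, ∑ y, a x y) / (∑ y, a v y) - 1 + 1 / p with hB
  have h1 : ∀ y, a x y * profile a p v y =
      a x y * B - a x y * a y v / p - if y = v then a x v * B else 0 := by
    intro y
    unfold profile
    split_ifs with hy
    · subst hy; rw [ha.apply_diag]; ring
    · rw [← hB]; ring
  simp only [h1, Finset.sum_sub_distrib, ← Finset.sum_mul]
  simp
  ring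

namespace IsQuasirandom

theorem profile_equation (h : IsQuasirandom a p η) {x v : V} (hx : x ≠ v) :
    (∑ y, a x y) * profile a p v x - ∑ y, a x y * profile a p v y =
      (∑ y, a x y) * (1 + residual a p v x) := by
  have hd := (h.degree_pos x).ne'
  rw [sum_mul_profile h.isAdjMatrix, residual, mul_add (∑ y, a x y) 1,
    mul_div_cancel₀ _ hd, profile, if_neg hx]
  ring

/-- Both `codeg (x, v) / p - deg x` and `2|E| / deg v - deg x / p` are of size `η * n / p`, because
their leading terms `p n - p n` and `n - n` cancel. -/
theorem abs_residual_le (h : IsQuasirandom a p η) {x v : V} (hx : x ≠ v) :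
    |residual a p v x| ≤ 16 * η / p ^ 2 := by
  have hp := h.pos
  have hp1 := h.lt_one
  have hη := h.error_pos
  have hn := h.card_pos
  have hd := h.degree_pos x
  have hS := abs_le.1 (h.abs_total_div_degree_sub_card_le v)
  have hdx := abs_le.1 (h.degree x)
  have hc := abs_le.1 (h.codegree x v hx)
  have hle := h.le_degree x
  have h1n := h.one_le
  have ha0 := h.nonneg x v
  have ha1 := h.le_one x v
  unfold residual
  rw [← Finset.sum_div]
  set n : ℝ := (Fintype.card V : ℝ)
  set S := (∑ x, ∑ y, a x y) / (∑ y, a v y)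
  set d := ∑ y, a x y
  set c := ∑ z, a x z * a z v
  have e1 : |c / p - d| ≤ 2 * η * n / p := by
    rw [show c / p - d = (c - p * d) / p by field_simp, abs_div, abs_of_pos hp]
    refine div_le_div_of_nonneg_right ?_ hp.le
    have : 0 < η * n := by positivity
    rw [abs_le]; constructor <;> nlinarith
  have e2 : |S - 1 + 1 / p - d / p| ≤ 6 * η * n / p := by
    rw [show S - 1 + 1 / p - d / p = (S - n) + ((1 - p) - (d - p * n)) / p by field_simp; ring]
    have : |((1 - p) - (d - p * n)) / p| ≤ 2 * η * n / p := by
      rw [abs_div, abs_of_pos hp]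
      refine div_le_div_of_nonneg_right ?_ hp.le
      rw [abs_le]; constructor <;> linarith
    calc _ ≤ |S - n| + |((1 - p) - (d - p * n)) / p| := abs_add_le _ _
      _ ≤ 4 * η * n / p + 2 * η * n / p := add_le_add (abs_le.2 hS) this
      _ = _ := by ring
  have e3 : |a x v * (S - 1 + 1 / p - d / p)| ≤ 6 * η * n / p := by
    rw [abs_mul, abs_of_nonneg ha0]
    exact (mul_le_of_le_one_left (abs_nonneg _) ha1).trans e2
  rw [abs_div, abs_of_pos hd, div_le_div_iff₀ hd (by positivity)]
  calc _ ≤ (2 * η * n / p + 6 * η * n / p) * p ^ 2 :=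
        mul_le_mul_of_nonneg_right ((abs_add_le _ _).trans (add_le_add e1 e3)) (by positivity)
    _ = 16 * η * (p / 2 * n) := by field_simp; ring
    _ ≤ 16 * η * d := mul_le_mul_of_nonneg_left hle (by positivity)

theorem profile_nonneg (h : IsQuasirandom a p η) (x v : V) : 0 ≤ profile a p v x := by
  unfold profile
  split_ifs
  · exact le_rfl
  · have h1 : 1 ≤ (∑ x, ∑ y, a x y) / (∑ y, a v y) := by
      rw [one_le_div (h.degree_pos v)]
      exact Finset.single_le_sum (f := fun x => ∑ y, a x y) (fun x _ => (h.degree_pos x).le)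
        (Finset.mem_univ v)
    have h2 : a x v / p ≤ 1 / p := div_le_div_of_nonneg_right (h.le_one x v) h.pos.le
    linarith

/-- The residual is at least `-1 / 2`, so doubling the profile compensates for it. -/
theorem two_mul_profile_supersolution (h : IsQuasirandom a p η) {x v : V} (hx : x ≠ v) :
    ∑ y, a x y + ∑ y, a x y * (2 * profile a p v y) ≤ (∑ y, a x y) * (2 * profile a p v x) := by
  have h1 := h.profile_equation hx
  have hp := h.pos
  have h2 : |residual a p v x| ≤ 1 / 2 := by
    refine (h.abs_residual_le hx).trans ?_
    rw [div_le_iff₀ (by positivity)]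
    linarith [h.error_le]
  have h3 : ∑ y, a x y * (2 * profile a p v y) = 2 * ∑ y, a x y * profile a p v y := by
    rw [Finset.mul_sum]; exact Finset.sum_congr rfl fun _ _ => by ring
  have h4 := (abs_le.1 h2).1
  have h5 : 0 ≤ (∑ y, a x y) * (1 / 2 + residual a p v x) :=
    mul_nonneg (h.degree_pos x).le (by linarith)
  rw [h3]
  linarith

/-- Kac's formula: averaging the hitting time over the neighbours of `v` gives
the expected return time minus one. -/
theorem sum_mul_eq_of_hitting_equation (h : IsQuasirandom a p η) {v : V} {H : V → ℝ}
    (hv : H v = 0)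
    (hH : ∀ x, x ≠ v → (∑ y, a x y) * H x = ∑ y, a x y + ∑ y, a x y * H y) :
    ∑ y, a v y * H y = ∑ x, ∑ y, a x y - ∑ y, a v y := by
  classical
  have h1 : ∑ x, ∑ y, a x y * H y = ∑ x, (∑ y, a x y) * H x := by
    rw [Finset.sum_comm]
    refine Finset.sum_congr rfl fun x _ => ?_
    rw [Finset.sum_mul]
    exact Finset.sum_congr rfl fun y _ => by rw [h.symm]
  have h2 : ∀ x, (∑ y, a x y) * H x = ∑ y, a x y + ∑ y, a x y * H y -
      if x = v then (∑ y, a v y + ∑ y, a v y * H y) else 0 := by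
    intro x
    split_ifs with hx
    · subst hx; rw [hv]; ring
    · rw [hH x hx]; ring
  have h3 : ∑ x, (∑ y, a x y) * H x = ∑ x, (∑ y, a x y + ∑ y, a x y * H y -
      if x = v then (∑ y, a v y + ∑ y, a v y * H y) else 0) :=
    Finset.sum_congr rfl fun x _ => h2 x
  rw [Finset.sum_sub_distrib, Finset.sum_add_distrib, h1] at h3
  simp at h3
  linarith

theorem abs_sub_profile_le (h : IsQuasirandom a p η) {v : V} {H : V → ℝ} (hv : H v = 0)
    (hH : ∀ x, x ≠ v → (∑ y, a x y) * H x = ∑ y, a x y + ∑ y, a x y * H y) (x : V) :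
    |H x - profile a p v x| ≤ 256 * η / p ^ 4 := by
  classical
  have hp := h.pos
  have hη := h.error_pos
  have hsum : ∀ x, ∑ y, a x y * (H y - profile a p v y) =
      ∑ y, a x y * H y - ∑ y, a x y * profile a p v y := fun x => by
    simp only [mul_sub, Finset.sum_sub_distrib]
  -- At `v` the residual of `H - profile` vanishes by Kac's formula.
  have key := h.abs_le_of_apply_eq_zero (e := fun x => H x - profile a p v x)
    (r := fun x => if x = v then 0 else -residual a p v x) (ρ := 16 * η / p ^ 2) (v := v)
    (fun x => by
      rw [hsum]
      split_ifs with hx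
      · subst hx
        have hsq : ∑ z, a x z * a z x / p = (∑ z, a x z) / p := by
          rw [Finset.sum_div]
          refine Finset.sum_congr rfl fun z _ => ?_
          rw [h.symm z x]
          rcases h.isAdjMatrix.zero_or_one x z with h0 | h0 <;> simp [h0]
        have hd := (h.degree_pos x).ne'
        rw [h.sum_mul_eq_of_hitting_equation hv hH, sum_mul_profile h.isAdjMatrix, hsq,
          h.isAdjMatrix.apply_diag, hv, profile, if_pos rfl]
        field_simp
        ring
      · have := h.profile_equation hx
        have := hH x hx
        linarith)
    (fun x => by
      split_ifs with hx
      · rw [abs_zero]; positivity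
      · rw [abs_neg]; exact h.abs_residual_le hx)
    (by simp [profile, hv]) x
  refine key.trans (le_of_eq ?_)
  field_simp
  norm_num

end IsQuasirandom
end Profile

/-! ### Concentration of degrees and codegrees -/

section Concentration

/-- Hoeffding's inequality for the number of occurrences among independent events of equal
probability. -/
theorem measureReal_le_abs_sum_indicator_sub_le {Ω ι : Type*} [MeasurableSpace Ω] {μ : Measure Ω}
    [IsProbabilityMeasure μ] {A : ι → Set Ω} (hA : ∀ i, MeasurableSet (A i))
    (hind : iIndepSet A μ) {T : Finset ι} {q : ℝ} (hq : ∀ i ∈ T, μ.real (A i) = q) {t : ℝ}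
    (ht : 0 ≤ t) :
    μ.real {ω | t ≤ |∑ i ∈ T, (A i).indicator (fun _ => (1 : ℝ)) ω - q * T.card|} ≤
      2 * Real.exp (-(2 * t ^ 2) / T.card) := by
  have hI : iIndepFun (fun i => (A i).indicator fun _ => (1 : ℝ)) μ := hind.iIndepFun_indicator
  have hsub : ∀ i ∈ T, HasSubgaussianMGF
      (fun ω => (A i).indicator (fun _ => (1 : ℝ)) ω - q) ((‖(1 : ℝ) - 0‖₊ / 2) ^ 2) μ := by
    intro i hi
    have h := hasSubgaussianMGF_of_mem_Icc (μ := μ) (a := 0) (b := 1)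
      (X := (A i).indicator fun _ => (1 : ℝ))
      ((measurable_const.indicator (hA i)).aemeasurable)
      (Eventually.of_forall fun ω => by
        by_cases hω : ω ∈ A i <;> simp [hω])
    rwa [integral_indicator_const _ (hA i), hq i hi, smul_eq_mul, mul_one] at h
  have hup := HasSubgaussianMGF.measure_sum_ge_le_of_iIndepFun
    (hI.comp (fun _ x => x - q) (fun _ => by fun_prop)) hsub ht
  have hlow := HasSubgaussianMGF.measure_sum_ge_le_of_iIndepFun
    (hI.comp (fun _ x => -(x - q)) (fun _ => by fun_prop)) (fun i hi => (hsub i hi).neg) ht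
  have hexp : -t ^ 2 / (2 * ((∑ _i ∈ T, (‖(1 : ℝ) - 0‖₊ / 2) ^ 2 : NNReal) : ℝ)) =
      -(2 * t ^ 2) / T.card := by
    simp
    rcases eq_or_ne (T.card : ℝ) 0 with h0 | h0
    · simp [h0]
    · field_simp
  simp only [NNReal.coe_sum] at hexp hup hlow
  rw [hexp] at hup hlow
  refine (measureReal_mono (fun ω hω => ?_)).trans ((measureReal_union_le _ _).trans
    ((add_le_add hup hlow).trans_eq (two_mul _).symm))
  have hω' : t ≤ |∑ i ∈ T, (A i).indicator (fun _ => (1 : ℝ)) ω - q * T.card| := hω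
  have hs : ∑ i ∈ T, ((A i).indicator (fun _ => (1 : ℝ)) ω - q) =
      ∑ i ∈ T, (A i).indicator (fun _ => (1 : ℝ)) ω - q * T.card := by
    rw [Finset.sum_sub_distrib]; simp [mul_comm]
  rcases le_abs.1 hω' with h | h
  · left
    simp only [Set.mem_ofPred_eq, Function.comp_def]
    rwa [hs]
  · right
    simp only [Set.mem_ofPred_eq, Function.comp_def, Finset.sum_neg_distrib]
    rwa [hs]

variable {V : Type*}

theorem measurableSet_subset_edgeSet [Countable V] (S : Finset (Sym2 V)) :
    MeasurableSet {G : SimpleGraph V | ↑S ⊆ G.edgeSet} := by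
  have : {G : SimpleGraph V | ↑S ⊆ G.edgeSet} = ⋂ e ∈ S, {G | e ∈ G.edgeSet} := by
    ext G; simp [Set.subset_def]
  rw [this]
  exact Finset.measurableSet_biInter _ fun e _ =>
    measurableSet_setOfPred.2 (measurable_set_iff.1 SimpleGraph.measurable_edgeSet e)

theorem binomialRandom_subset_edgeSet [Countable V] (p : I) (S : Finset (Sym2 V))
    (hS : ∀ e ∈ S, ¬ e.IsDiag) :
    (SimpleGraph.binomialRandom V p) {G | ↑S ⊆ G.edgeSet} = ENNReal.ofReal p ^ S.card := by
  rw [SimpleGraph.binomialRandom_eq_map, setBernoulli_eq_map,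
    Measure.map_map (by fun_prop) (by fun_prop), Measure.map_apply (by fun_prop)]
  · have : (SimpleGraph.fromEdgeSet ∘ fun p : Sym2 V → Prop => {i | p i}) ⁻¹'
        {G | ↑S ⊆ G.edgeSet} = Set.pi S fun _ => {True} := by
      ext P
      simp only [Set.mem_preimage, Function.comp_apply, Set.mem_ofPred_eq,
        SimpleGraph.edgeSet_fromEdgeSet, Set.mem_pi, Set.mem_singleton_iff, Set.subset_def]
      refine forall₂_congr fun e he => ?_
      have := hS e he
      simp [this]
    rw [this, Measure.infinitePi_pi _ fun _ _ => MeasurableSet.of_discrete,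
      Finset.prod_congr rfl (g := fun _ => ENNReal.ofReal p), Finset.prod_const]
    intro e he
    have := hS e he
    have hcoe : ENNReal.ofReal p = unitInterval.toNNReal p := by
      rw [← unitInterval.coe_toNNReal p, ENNReal.ofReal_coe_nnreal]
    simp [this, hcoe]
  · exact measurableSet_subset_edgeSet S


/-- The edges that make `u` a common neighbour of `v` and `w`; none are listed when `u` is `v` or
`w`. For `v = w` the set is a single edge. -/
def cherry [DecidableEq V] (v w u : V) : Finset (Sym2 V) :=
  if u = v ∨ u = w then ∅ else {s(v, u), s(w, u)}

theorem not_isDiag_of_mem_cherry [DecidableEq V] {v w u : V} {e : Sym2 V}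
    (he : e ∈ cherry v w u) : ¬ e.IsDiag := by
  unfold cherry at he
  split_ifs at he with h
  · simp at he
  · push Not at h
    simp only [Finset.mem_insert, Finset.mem_singleton] at he
    rcases he with rfl | rfl
    · simpa using h.1.symm
    · simpa using h.2.symm

theorem disjoint_cherry [DecidableEq V] (v w : V) {u u' : V} (huu : u ≠ u') :
    Disjoint (cherry v w u) (cherry v w u') := by
  rw [Finset.disjoint_left]
  intro e he he'
  unfold cherry at he he'
  split_ifs at he he' <;> simp at he he'
  grind

theorem card_cherry [DecidableEq V] {v w u : V} (hv : u ≠ v) (hw : u ≠ w) :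
    (cherry v w u).card = if v = w then 1 else 2 := by
  unfold cherry
  rw [if_neg (by tauto)]
  split_ifs with h
  · simp [h]
  · rw [Finset.card_pair]
    simpa using ⟨h, fun h' => absurd h' (Ne.symm hv)⟩

theorem iIndepSet_cherry [Countable V] [DecidableEq V] (p : I) (v w : V) :
    iIndepSet (fun u => {G : SimpleGraph V | ↑(cherry v w u) ⊆ G.edgeSet})
      (SimpleGraph.binomialRandom V p) := by
  rw [iIndepSet_iff_meas_biInter fun u => measurableSet_subset_edgeSet _]
  intro T
  have : ⋂ u ∈ T, {G : SimpleGraph V | ↑(cherry v w u) ⊆ G.edgeSet} =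
      {G | ↑(T.biUnion (cherry v w)) ⊆ G.edgeSet} := by
    ext G; simp
  rw [this, binomialRandom_subset_edgeSet, Finset.card_biUnion, Finset.prod_congr rfl
    fun u _ => binomialRandom_subset_edgeSet p _ fun e he => not_isDiag_of_mem_cherry he,
    Finset.prod_pow_eq_pow_sum]
  · exact fun u _ u' _ h => disjoint_cherry v w h
  · intro e he
    obtain ⟨u, -, hu⟩ := Finset.mem_biUnion.1 he
    exact not_isDiag_of_mem_cherry hu

open scoped Classical in
/-- Outside `{v, w}` the common neighbours of `v` and `w` are counted by independent events. -/
theorem sum_adjMatrix_mul_eq [Fintype V] [DecidableEq V] (G : SimpleGraph V) (v w : V) :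
    ∑ z, G.adjMatrix ℝ v z * G.adjMatrix ℝ z w =
      ∑ u ∈ Finset.univ \ {v, w},
        {G : SimpleGraph V | ↑(cherry v w u) ⊆ G.edgeSet}.indicator (fun _ => (1 : ℝ)) G := by
  rw [← Finset.sum_sdiff (Finset.subset_univ {v, w})]
  rw [Finset.sum_eq_zero (s := {v, w}), add_zero]
  · refine Finset.sum_congr rfl fun u hu => ?_
    simp only [Finset.mem_sdiff, Finset.mem_univ, true_and, Finset.mem_insert,
      Finset.mem_singleton] at hu
    simp only [SimpleGraph.adjMatrix_apply, cherry, if_neg hu, Set.indicator_apply,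
      Set.mem_ofPred_eq, Finset.coe_insert, Finset.coe_singleton, Set.insert_subset_iff,
      Set.singleton_subset_iff, SimpleGraph.mem_edgeSet, G.adj_comm w u]
    split_ifs <;> simp_all
  · intro u hu
    simp only [Finset.mem_insert, Finset.mem_singleton] at hu
    rcases hu with rfl | rfl <;> simp

open scoped Classical in
/-- The additive `2` accounts for the vertices `v` and `w`, which are not among the independent
events. The case `v = w` is the degree, of density `p` rather than `p ^ 2`. -/
theorem measureReal_codegree_deviation_le [Fintype V] [DecidableEq V]
    (hV : 2 < Fintype.card V) (p : I) (v w : V) {t : ℝ} (ht : 0 ≤ t) :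
    (SimpleGraph.binomialRandom V p).real
      {G | t + 2 ≤ |∑ z, G.adjMatrix ℝ v z * G.adjMatrix ℝ z w -
        (p : ℝ) ^ (if v = w then 1 else 2) * Fintype.card V|} ≤
      2 * Real.exp (-(2 * t ^ 2) / Fintype.card V) := by
  set T : Finset V := Finset.univ \ {v, w} with hT
  have hcard : (T.card : ℝ) ≤ Fintype.card V := by exact_mod_cast Finset.card_le_univ T
  have hcard2 : (Fintype.card V : ℝ) ≤ T.card + 2 := by
    have h1 := Finset.card_le_two (a := v) (b := w)
    have h2 : Fintype.card V - ({v, w} : Finset V).card ≤ T.card := Finset.le_card_sdiff _ _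
    have : Fintype.card V ≤ T.card + 2 := by omega
    exact_mod_cast this
  set k := if v = w then 1 else 2 with hk
  have hq0 : (0 : ℝ) ≤ (p : ℝ) ^ k := pow_nonneg p.2.1 k
  have hq1 : (p : ℝ) ^ k ≤ 1 := pow_le_one₀ p.2.1 p.2.2
  have hq : ∀ u ∈ T, (SimpleGraph.binomialRandom V p).real
      {G : SimpleGraph V | ↑(cherry v w u) ⊆ G.edgeSet} = (p : ℝ) ^ k := by
    intro u hu
    simp only [hT, Finset.mem_sdiff, Finset.mem_univ, true_and, Finset.mem_insert,
      Finset.mem_singleton, not_or] at hu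
    rw [measureReal_def, binomialRandom_subset_edgeSet p _ fun e he => not_isDiag_of_mem_cherry he,
      card_cherry hu.1 hu.2, ENNReal.toReal_pow, ENNReal.toReal_ofReal p.2.1]
  have hmain := measureReal_le_abs_sum_indicator_sub_le
    (fun u => measurableSet_subset_edgeSet (cherry v w u)) (iIndepSet_cherry p v w) hq ht
  have h0 : (0 : ℝ) < T.card := by
    have : (2 : ℝ) < Fintype.card V := by exact_mod_cast hV
    linarith
  refine (measureReal_mono fun G hG => ?_).trans (hmain.trans ?_)
  · simp only [Set.mem_ofPred_eq] at hG ⊢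
    rw [← sum_adjMatrix_mul_eq]
    have h3 : |(p : ℝ) ^ k * Fintype.card V - (p : ℝ) ^ k * T.card| ≤ 2 := by
      rw [← mul_sub, abs_of_nonneg (mul_nonneg hq0 (by linarith))]
      nlinarith
    have h4 := abs_sub_le (∑ z, G.adjMatrix ℝ v z * G.adjMatrix ℝ z w) ((p : ℝ) ^ k * T.card)
      ((p : ℝ) ^ k * Fintype.card V)
    rw [abs_sub_comm ((p : ℝ) ^ k * T.card)] at h4
    linarith
  · gcongr 2 * Real.exp ?_
    rw [neg_div, neg_div, neg_le_neg_iff]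
    gcongr

open scoped Classical in
theorem measure_not_isQuasirandom_le {n : ℕ} (hn : 3 ≤ n) {p : I} (hp0 : 0 < p) (hp1 : p < 1)
    (hη : 4 * √(Real.log n / n) ≤ (p : ℝ) ^ 2 / 32) :
    SimpleGraph.binomialRandom (Fin n) p
      {G | ¬ IsQuasirandom (G.adjMatrix ℝ) p (4 * √(Real.log n / n))} ≤
      ENNReal.ofReal (2 / n) := by
  have hn0 : (0 : ℝ) < n := by positivity
  have hlog : 1 ≤ Real.log n := by
    rw [Real.le_log_iff_exp_le hn0]
    have : (3 : ℝ) ≤ n := by exact_mod_cast hn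
    linarith [Real.exp_one_lt_d9]
  have hmul : √(Real.log n / n) * n = √(n * Real.log n) := by
    rw [show (n : ℝ) * Real.log n = (Real.log n / n) * n ^ 2 by field_simp,
      Real.sqrt_mul (by positivity), Real.sqrt_sq hn0.le]
  have h1 : 1 ≤ √(n * Real.log n) := by
    rw [Real.one_le_sqrt]
    have : (3 : ℝ) ≤ n := by exact_mod_cast hn
    nlinarith
  set t := 2 * √(n * Real.log n) with ht
  set bad : Fin n → Fin n → Set (SimpleGraph (Fin n)) := fun v w =>
    {G | t + 2 ≤ |∑ z, G.adjMatrix ℝ v z * G.adjMatrix ℝ z w -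
        (p : ℝ) ^ (if v = w then 1 else 2) * Fintype.card (Fin n)|} with hbad
  have hle : ∀ v w, SimpleGraph.binomialRandom (Fin n) p (bad v w) ≤
      ENNReal.ofReal (2 / n ^ 3) := by
    intro v w
    rw [← ofReal_measureReal]
    refine ENNReal.ofReal_le_ofReal ((measureReal_codegree_deviation_le
      (by rw [Fintype.card_fin]; omega) p v w (t := t) (by rw [ht]; positivity)).trans ?_)
    rw [div_eq_mul_inv 2, Fintype.card_fin]
    refine mul_le_mul_of_nonneg_left ?_ zero_le_two
    have hexp : Real.exp (-(3 * Real.log n)) = ((n : ℝ) ^ 3)⁻¹ := by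
      rw [Real.exp_neg, show 3 * Real.log n = Real.log (n ^ 3) by simp,
        Real.exp_log (by positivity)]
    rw [← hexp, Real.exp_le_exp, ht, mul_pow, Real.sq_sqrt (by positivity)]
    field_simp
    norm_num
  have hsub : {G | ¬ IsQuasirandom (G.adjMatrix ℝ) p (4 * √(Real.log n / n))} ⊆
      ⋃ v, ⋃ w, bad v w := by
    intro G hG
    by_contra hcon
    have hgood : ∀ v w : Fin n, |∑ z, G.adjMatrix ℝ v z * G.adjMatrix ℝ z w -
        (p : ℝ) ^ (if v = w then 1 else 2) * Fintype.card (Fin n)| ≤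
          4 * √(Real.log n / n) * Fintype.card (Fin n) := by
      intro v w
      simp only [Set.mem_iUnion, not_exists, hbad, Set.mem_ofPred_eq, not_le] at hcon
      refine (hcon v w).le.trans ?_
      rw [Fintype.card_fin, mul_assoc, hmul, ht]
      linarith
    refine hG ⟨G.isAdjMatrix_adjMatrix ℝ, hp0, hp1, hη, ?_, fun v => ?_, fun v w hvw => ?_⟩
    · rw [Fintype.card_fin, mul_assoc, hmul]; linarith
    · have h := hgood v v
      rw [if_pos rfl, pow_one] at h
      refine le_trans (le_of_eq ?_) h
      congr 2
      refine Finset.sum_congr rfl fun z _ => ?_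
      simp [SimpleGraph.adjMatrix_apply, G.adj_comm z v]
    · simpa only [if_neg hvw] using hgood v w
  calc _ ≤ SimpleGraph.binomialRandom (Fin n) p (⋃ v, ⋃ w, bad v w) := measure_mono hsub
    _ ≤ ∑ v, ∑ w, SimpleGraph.binomialRandom (Fin n) p (bad v w) :=
        (measure_iUnion_fintype_le _ _).trans
          (Finset.sum_le_sum fun v _ => measure_iUnion_fintype_le _ _)
    _ ≤ ∑ _v : Fin n, ∑ _w : Fin n, ENNReal.ofReal (2 / n ^ 3) :=
        Finset.sum_le_sum fun v _ => Finset.sum_le_sum fun w _ => hle v w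
    _ = ENNReal.ofReal (2 / n) := by
        simp only [Finset.sum_const, Finset.card_univ, Fintype.card_fin, nsmul_eq_mul]
        rw [← ENNReal.ofReal_natCast, ← ENNReal.ofReal_mul hn0.le, ← ENNReal.ofReal_mul hn0.le]
        congr 1
        field_simp

end Concentration

/-! ### Hitting times on quasirandom and random graphs -/

open scoped Classical in
/-- On a quasirandom graph the hitting times are finite and close to the profile. -/
theorem hittingTime_of_isQuasirandom {V : Type*} [Fintype V] [MeasurableSpace V]
    [MeasurableSingletonClass V] {G : SimpleGraph V} {p η : ℝ}
    (h : IsQuasirandom (G.adjMatrix ℝ) p η) {v w : V} (hwv : w ≠ v) :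
    hittingTime G w v ≠ ∞ ∧
      |(hittingTime G w v).toReal - (2 * (G.edgeFinset.card : ℝ) / (G.degree v : ℝ) +
        if G.Adj w v then -1 else -1 + 1 / p)| ≤ 256 * η / p ^ 4 := by
  have hsum : ∀ x (φ : V → ℝ), ∑ y, G.adjMatrix ℝ x y * φ y = ∑ y ∈ G.neighborFinset x, φ y := by
    intro x φ
    simp [SimpleGraph.adjMatrix_apply, Finset.sum_ite, G.neighborFinset_eq_filter]
  have hdeg : ∀ x, ∑ y, G.adjMatrix ℝ x y = G.degree x := by
    intro x
    simpa using hsum x fun _ => 1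
  have hpos : ∀ x, 0 < G.degree x := by
    intro x
    have := h.degree_pos x
    rw [hdeg] at this
    exact_mod_cast this
  have hfin : ∀ x, hittingTime G x v ≠ ∞ := by
    refine hittingTime_ne_top_of_supersolution G v hpos
      (fun x => 2 * profile (G.adjMatrix ℝ) p v x)
      (fun x => mul_nonneg zero_le_two (h.profile_nonneg x v)) fun x hx => ?_
    have := h.two_mul_profile_supersolution hx
    rwa [hsum, hdeg] at this
  refine ⟨hfin w, ?_⟩
  have hH := h.abs_sub_profile_le (v := v) (H := fun x => (hittingTime G x v).toReal)
    (by simp [hittingTime_self]) (fun x hx => by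
      rw [hsum, hdeg]
      exact hittingTime_mul_degree G hx (hpos x) hfin) w
  have htotal : ∑ x, ∑ y, G.adjMatrix ℝ x y = 2 * (G.edgeFinset.card : ℝ) := by
    simp only [hdeg]
    exact_mod_cast G.sum_degrees_eq_twice_card_edges
  have hprof : profile (G.adjMatrix ℝ) p v w = 2 * (G.edgeFinset.card : ℝ) / (G.degree v : ℝ) +
      if G.Adj w v then -1 else -1 + 1 / p := by
    rw [profile, if_neg hwv, htotal, hdeg, SimpleGraph.adjMatrix_apply]
    split_ifs <;> ring
  rwa [hprof] at hH

end RandomWalk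

open scoped Classical in
theorem theorem1 (p : I) (hp0 : 0 < p) (hp1 : p < 1) :
    ∃ C : ℝ, 0 < C ∧
      Tendsto
        (fun n : ℕ => SimpleGraph.binomialRandom (Fin n) p
          {G : SimpleGraph (Fin n) | ∀ v w : Fin n, w ≠ v →
            RandomWalk.hittingTime G w v ≠ ∞ ∧
            |(RandomWalk.hittingTime G w v).toReal -
                (2 * (G.edgeFinset.card : ℝ) / (G.degree v : ℝ) +
                  if G.Adj w v then -1 else -1 + 1 / (p : ℝ))| ≤
              C * (Real.log n ^ (3 / 2 : ℝ) / √(n : ℝ))})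
        atTop (𝓝 1) := by
  have hp : (0 : ℝ) < p := hp0
  refine ⟨1024 / (p : ℝ) ^ 4, by positivity, ?_⟩
  have hsmall : ∀ᶠ n : ℕ in atTop, 4 * √(Real.log n / n) ≤ (p : ℝ) ^ 2 / 32 := by
    have h1 : Tendsto (fun n : ℕ => Real.log n / n) atTop (𝓝 0) :=
      (Real.isLittleO_log_id_atTop.tendsto_div_nhds_zero).comp tendsto_natCast_atTop_atTop
    have h2 : Tendsto (fun n : ℕ => 4 * √(Real.log n / n)) atTop (𝓝 0) := by
      simpa using h1.sqrt.const_mul 4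
    exact h2.eventually_le_const (by positivity)
  have hlower : Tendsto (fun n : ℕ => 1 - ENNReal.ofReal (2 / n)) atTop (𝓝 1) := by
    have h1 : Tendsto (fun n : ℕ => ENNReal.ofReal (2 / n)) atTop (𝓝 0) := by
      simpa using ENNReal.tendsto_ofReal (tendsto_const_div_atTop_nhds_zero_nat 2)
    simpa using ENNReal.Tendsto.sub tendsto_const_nhds h1 (Or.inl ENNReal.one_ne_top)
  refine tendsto_of_tendsto_of_tendsto_of_le_of_le' hlower tendsto_const_nhds ?_
    (Eventually.of_forall fun n => prob_le_one)
  filter_upwards [hsmall, eventually_ge_atTop 3] with n hη hn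
  rw [tsub_le_iff_right]
  have hn0 : (0 : ℝ) < n := by positivity
  have hlog : 1 ≤ Real.log n := by
    rw [Real.le_log_iff_exp_le hn0]
    have : (3 : ℝ) ≤ n := by exact_mod_cast hn
    linarith [Real.exp_one_lt_d9]
  have herr : 256 * (4 * √(Real.log n / n)) / (p : ℝ) ^ 4 ≤
      1024 / (p : ℝ) ^ 4 * (Real.log n ^ (3 / 2 : ℝ) / √(n : ℝ)) := by
    have h1 : √(Real.log n) ≤ Real.log n ^ (3 / 2 : ℝ) := by
      rw [Real.sqrt_eq_rpow]
      exact Real.rpow_le_rpow_of_exponent_le hlog (by norm_num)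
    rw [Real.sqrt_div (by linarith), show 256 * (4 * (√(Real.log n) / √(n : ℝ))) / (p : ℝ) ^ 4 =
      1024 / (p : ℝ) ^ 4 * (√(Real.log n) / √(n : ℝ)) by ring]
    gcongr
  rw [← measure_univ (μ := SimpleGraph.binomialRandom (Fin n) p)]
  -- Subadditivity suffices: no measurability of the event is needed.
  refine (measure_mono fun G _ => ?_).trans ((measure_union_le _ _).trans
    (add_le_add_right (RandomWalk.measure_not_isQuasirandom_le hn hp0 hp1 hη) _))
  by_cases hG : RandomWalk.IsQuasirandom (G.adjMatrix ℝ) p (4 * √(Real.log n / n))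
  · left
    intro v w hwv
    obtain ⟨h1, h2⟩ := RandomWalk.hittingTime_of_isQuasirandom hG hwv
    exact ⟨h1, h2.trans herr⟩
  · right
    exact hG
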